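/- For a Coxeter matrix $M=(m(\alpha,\beta))_{\alpha,\beta\in I}$ of finite type, let $G_M^+$ be its Artin monoid, i.e. the monoid presented by letters $a_i$ $(i\in I)$ and the relations $a_\alpha a_\beta a_\alpha\cdots=a_\beta a_\alpha a_\beta\cdots$ ($m(\alpha,\beta)$ letters on each side) for $\alpha\neq\beta$, and let $\deg:G_M^+\to\mathbb Z_{\ge 0}$ be the word length. For $J\subset I$ let $\Delta_J$ be the fundamental element, i.e. the right least common multiple of the letters $a_i$, $i\in J$: the element $\Delta$ that lies in $a_iG_M^+$ for every $i\in J$ and is such that every element of $\bigcap_{i\in J}a_iG_M^+$ lies in $\Delta G_M^+$. Put $$N_M(t)=\sum_{J\subset I}(-1)^{\#J}\,t^{\deg(\Delta_J)}.$$ Let $l\ge 2$ and $I=\{1,\dots,l\}$, and write $N_{A_l}$ and $N_{B_l}$ for $N_M$ when $M$ is the Coxeter matrix of type $A_l$ ($m(\alpha,\alpha)=1$, $m(\alpha,\beta)=3$ if $|\alpha-\beta|=1$, and $m(\alpha,\beta)=2$ if $|\alpha-\beta|>1$), respectively of type $B_l$ (the same, except that $m(1,2)=m(2,1)=4$). **Theorem.**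 In both cases $\Delta_J$ exists and is unique for every $J\subset I$, and the derivatives at $t=1$ satisfy $$N'_{B_l}(1)-N'_{A_l}(1)=(-1)^l(l-1)\qquad\text{and}\qquad N'_{B_l}(1)=(-1)^l\,l.$$ -/

import Mathlib

open Polynomial

noncomputable section

namespace ArtinMonoid

variable {I : Type*}

/-- The defining relations of the Artin monoid of a Coxeter matrix `M`: for all `i`, `j`, the
alternating word `⋯ a_j a_i a_j` and the alternating word `⋯ a_i a_j a_i`, both with `M i j`
letters, are identified. (The entry `0` encodes `∞`: no relation. For `i = j` it is trivial.) -/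
inductive Rel (M : CoxeterMatrix I) : FreeMonoid I → FreeMonoid I → Prop
  | braid (i j : I) : Rel M
      (FreeMonoid.ofList (CoxeterSystem.alternatingWord i j (M i j)))
      (FreeMonoid.ofList (CoxeterSystem.alternatingWord j i (M i j)))

end ArtinMonoid

/-- The Artin monoid `G_M⁺` of a Coxeter matrix `M`, presented by the letters `a_i` and the braid
relations. -/
abbrev ArtinMonoid {I : Type*} (M : CoxeterMatrix I) : Type _ :=
  PresentedMonoid (ArtinMonoid.Rel M)

namespace ArtinMonoid

variable {I : Type*}

/-- The letter `a_i`, as an element of the Artin monoid. -/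
def letter (M : CoxeterMatrix I) (i : I) : ArtinMonoid M :=
  PresentedMonoid.of (Rel M) i

/-- The braid relations are homogeneous, so the length of words descends to the Artin monoid. -/
theorem length_eq_of_rel (M : CoxeterMatrix I) (a b : FreeMonoid I) (h : Rel M a b) :
    FreeMonoid.lift (fun _ : I => Multiplicative.ofAdd (1 : ℕ)) a =
      FreeMonoid.lift (fun _ : I => Multiplicative.ofAdd (1 : ℕ)) b := by
  cases h with
  | braid i j => simp [FreeMonoid.lift_apply]

/-- The degree as a monoid homomorphism to `(ℕ, +)`, sending each letter to `1`. -/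
def degHom (M : CoxeterMatrix I) : ArtinMonoid M →* Multiplicative ℕ :=
  PresentedMonoid.lift (fun _ : I => Multiplicative.ofAdd (1 : ℕ)) (length_eq_of_rel M)

/-- The degree of an element: the length of any word that represents it. -/
def deg (M : CoxeterMatrix I) (u : ArtinMonoid M) : ℕ :=
  Multiplicative.toAdd (degHom M u)

/-- `D` is a right least common multiple of the letters `a_i`, `i ∈ J`. Divisibility `a ∣ b` in a
monoid means that `b = a * c` for some `c`, that is, `b` is a right multiple of `a`. -/
def IsRightLcm (M : CoxeterMatrix I) (J : Finset I) (D : ArtinMonoid M) : Prop :=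
  (∀ i ∈ J, letter M i ∣ D) ∧
    ∀ E : ArtinMonoid M, (∀ i ∈ J, letter M i ∣ E) → D ∣ E

open Classical in
/-- The fundamental element `Δ_J`: the right least common multiple of the letters `a_i`, `i ∈ J`
(with the value `1` if there is none). -/
def fundamentalElement (M : CoxeterMatrix I) (J : Finset I) : ArtinMonoid M :=
  if h : ∃ D : ArtinMonoid M, IsRightLcm M J D then h.choose else 1

/-- The skew-growth function `N_M(t) = ∑_{J ⊆ I} (-1)^{#J} t^{deg Δ_J}`, a polynomial in `t`. -/
def skewGrowth [Fintype I] (M : CoxeterMatrix I) : ℤ[X] :=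
  ∑ J : Finset I, (-1) ^ J.card * X ^ deg M (fundamentalElement M J)

/-- The Coxeter matrix of type `B_l` whose label `4` sits between the first two vertices. The
element `i : Fin l` stands for the vertex `i + 1 ∈ {1, …, l}`. -/
def typeB (l : ℕ) : CoxeterMatrix (Fin l) where
  M := Matrix.of fun i j : Fin l =>
    if i = j then 1
    else if ((i : ℕ) + 1) + ((j : ℕ) + 1) = 3 then 4
    else if (i : ℕ) + 1 = j ∨ (j : ℕ) + 1 = i then 3
    else 2
  isSymm := by
    ext i j
    simp only [Matrix.transpose_apply, Matrix.of_apply, eq_comm (a := j) (b := i),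
      add_comm ((j : ℕ) + 1) ((i : ℕ) + 1), or_comm (a := (j : ℕ) + 1 = i)]
  diagonal := by simp
  off_diagonal := by
    intro i j h
    simp only [Matrix.of_apply, if_neg h]
    split_ifs <;> decide

end ArtinMonoid

end

/-! At `t = 1` the derivative is `∑_J (-1)^{#J} deg Δ_J`, so only the degrees of the `Δ_J` matter.
Both diagrams are chains that differ in the first label; the proposition `e` records whether it is
4.

The basis is the reduction property (`join_of_mul_eq`): if `a_i A = a_j B`, both sides are right
multiples of the alternating word of length `m(i,j)`. It is proved by induction on the degree, along
a derivation that links two words. The crucial case is transitivity (`BraidJoin.trans`), which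
involves three letters and so is a finite check in rank three. Left cancellation and the lcm of two
letters follow.

The lcm of the letters of `J` is then built vertex by vertex (`letter_dvd_chainTail_mul_iff`). To
absorb `a_n`, the lcm of the earlier letters is multiplied by `a_n a_{n-1} ⋯ a_k`, where `k, …, n-1`
is the run of `J` that ends just before `n`. If `e` holds and the run reaches 0, the factor is `a_n
⋯ a_1 a_0 a_1 ⋯ a_n`.

Finally, pairing `J` with `J ∪ {n}` reduces the signed sum of lcm degrees to `-S_n`, where `S_n` is
the signed sum of the degrees of these factors. A second pairing gives `S_{n+1} = -S_n - (-1)^n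
[e]`, where the extra term comes from the single full subset. Since `S_0 = 1`, the derivative is
`(-1)^l` without the label 4 and `(-1)^l l` with it. -/

noncomputable section

/-! ### Transitivity of braid joins in rank three -/

/-- The map `x ∘ y ∘ x ∘ ⋯` with `m` factors. -/
def altMap {α : Type*} (x y : α → α) : ℕ → α → α
  | 0 => id
  | m + 1 => fun A => x (altMap y x m A)

/-- `x A` and `y B` are the same multiple of the common value of the two alternating maps of
length `m`. -/
def BraidJoin {α : Type*} (m : ℕ) (x y : α → α) (A B : α) : Prop :=
  ∃ W, A = altMap y x (m - 1) W ∧ B = altMap x y (m - 1) W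

/-- The maps `x` and `y` satisfy the braid relation of length `m`, and, in degrees below `n`, every
coincidence of their values comes from it. -/
structure BraidBelow {α : Type*} (d : α → ℕ) (n m : ℕ) (x y : α → α) : Prop where
  deg_left : ∀ A, d (x A) = d A + 1
  deg_right : ∀ A, d (y A) = d A + 1
  rel : ∀ A, altMap x y m A = altMap y x m A
  join : ∀ A B, d A < n → x A = y B → BraidJoin m x y A B

section Cube

variable {α : Type*} {d : α → ℕ} {n m : ℕ} {x y z : α → α} {A B C : α}

theorem BraidJoin.symm (h : BraidJoin m x y A B) : BraidJoin m y x B A := by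
  obtain ⟨W, h₁, h₂⟩ := h
  exact ⟨W, h₂, h₁⟩

theorem BraidBelow.symm (h : BraidBelow d n m x y) : BraidBelow d n m y x where
  deg_left := h.deg_right
  deg_right := h.deg_left
  rel A := (h.rel A).symm
  join A B hA e := (h.join B A (by
    have := congrArg d e
    rw [h.deg_left, h.deg_right] at this
    omega) e.symm).symm

theorem BraidBelow.two (h : BraidBelow d n 2 x y) : ∀ A B, d A < n → x A = y B →
    ∃ W, A = y W ∧ B = x W := h.join

theorem BraidBelow.three (h : BraidBelow d n 3 x y) : ∀ A B, d A < n → x A = y B →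
    ∃ W, A = y (x W) ∧ B = x (y W) := h.join

theorem BraidBelow.four (h : BraidBelow d n 4 x y) : ∀ A B, d A < n → x A = y B →
    ∃ W, A = y (x (y W)) ∧ B = x (y (x W)) := h.join

/-- In this and the following lemmas the three numbers are the labels of `xz`, `zy` and `xy`. The
two expressions for `C` are compared, and known coincidences in degree below `n` are applied until a
free element remains. The final witness is such that `x A` is the longest word of the rank three
system applied to that element. -/
theorem cube_two_two_two (hxz : BraidBelow d n 2 x z)
    (hzy : BraidBelow d n 2 z y) (hxy : BraidBelow d n 2 x y)
    (hA : d A ≤ n) (h₁ : BraidJoin 2 x z A C) (h₂ : BraidJoin 2 z y C B) :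
    BraidJoin 2 x y A B := by
  obtain ⟨dx, dz, rxz, -⟩ := id hxz
  obtain ⟨-, dy, rzy, -⟩ := id hzy
  obtain ⟨-, -, rxy, -⟩ := id hxy
  obtain ⟨W, rfl, rfl⟩ := h₁
  obtain ⟨V, h, rfl⟩ := h₂
  simp only [altMap, id, Nat.reduceSub] at *
  simp only [dx, dz] at hA
  have e := congrArg d h
  simp only [dx, dy, dz] at e
  obtain ⟨U, rfl, rfl⟩ := hxy.two W V (by omega) ‹_›
  exact ⟨z U,
    by simp only [altMap, id]; clear * - rxz rzy rxy; grind only,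
    by simp only [altMap, id]; clear * - rxz rzy rxy; grind only⟩

theorem cube_two_two_three (hxz : BraidBelow d n 2 x z)
    (hzy : BraidBelow d n 2 z y) (hxy : BraidBelow d n 3 x y)
    (hA : d A ≤ n) (h₁ : BraidJoin 2 x z A C) (h₂ : BraidJoin 2 z y C B) :
    BraidJoin 3 x y A B := by
  obtain ⟨dx, dz, rxz, -⟩ := id hxz
  obtain ⟨-, dy, rzy, -⟩ := id hzy
  obtain ⟨-, -, rxy, -⟩ := id hxy
  obtain ⟨W, rfl, rfl⟩ := h₁
  obtain ⟨V, h, rfl⟩ := h₂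
  simp only [altMap, id, Nat.reduceSub] at *
  simp only [dx, dz] at hA
  have e := congrArg d h
  simp only [dx, dy, dz] at e
  obtain ⟨U, rfl, rfl⟩ := hxy.three W V (by omega) ‹_›
  exact ⟨z U,
    by simp only [altMap, id]; clear * - rxz rzy rxy; grind only,
    by simp only [altMap, id]; clear * - rxz rzy rxy; grind only⟩

theorem cube_two_two_four (hxz : BraidBelow d n 2 x z)
    (hzy : BraidBelow d n 2 z y) (hxy : BraidBelow d n 4 x y)
    (hA : d A ≤ n) (h₁ : BraidJoin 2 x z A C) (h₂ : BraidJoin 2 z y C B) :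
    BraidJoin 4 x y A B := by
  obtain ⟨dx, dz, rxz, -⟩ := id hxz
  obtain ⟨-, dy, rzy, -⟩ := id hzy
  obtain ⟨-, -, rxy, -⟩ := id hxy
  obtain ⟨W, rfl, rfl⟩ := h₁
  obtain ⟨V, h, rfl⟩ := h₂
  simp only [altMap, id, Nat.reduceSub] at *
  simp only [dx, dz] at hA
  have e := congrArg d h
  simp only [dx, dy, dz] at e
  obtain ⟨U, rfl, rfl⟩ := hxy.four W V (by omega) ‹_›
  exact ⟨z U,
    by simp only [altMap, id]; clear * - rxz rzy rxy; grind only,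
    by simp only [altMap, id]; clear * - rxz rzy rxy; grind only⟩

theorem cube_three_two_two (hxz : BraidBelow d n 3 x z)
    (hzy : BraidBelow d n 2 z y) (hxy : BraidBelow d n 2 x y)
    (hA : d A ≤ n) (h₁ : BraidJoin 3 x z A C) (h₂ : BraidJoin 2 z y C B) :
    BraidJoin 2 x y A B := by
  obtain ⟨dx, dz, rxz, -⟩ := id hxz
  obtain ⟨-, dy, rzy, -⟩ := id hzy
  obtain ⟨-, -, rxy, -⟩ := id hxy
  obtain ⟨W, rfl, rfl⟩ := h₁
  obtain ⟨V, h, rfl⟩ := h₂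
  simp only [altMap, id, Nat.reduceSub] at *
  simp only [dx, dz] at hA
  have e := congrArg d h
  simp only [dx, dy, dz] at e
  obtain ⟨T, hT, rfl⟩ := hxy.two (z W) V
    (by simp only [dx, dy, dz] at hA ⊢; omega) ‹_›
  have eT := congrArg d hT
  simp only [dx, dy, dz] at eT
  obtain ⟨U, rfl, rfl⟩ := hzy.two W T (by omega) ‹_›
  exact ⟨z (x U),
    by simp only [altMap, id]; clear * - rxz rzy rxy; grind only,
    by simp only [altMap, id]; clear * - rxz rzy rxy; grind only⟩

theorem cube_four_two_two (hxz : BraidBelow d n 4 x z)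
    (hzy : BraidBelow d n 2 z y) (hxy : BraidBelow d n 2 x y)
    (hA : d A ≤ n) (h₁ : BraidJoin 4 x z A C) (h₂ : BraidJoin 2 z y C B) :
    BraidJoin 2 x y A B := by
  obtain ⟨dx, dz, rxz, -⟩ := id hxz
  obtain ⟨-, dy, rzy, -⟩ := id hzy
  obtain ⟨-, -, rxy, -⟩ := id hxy
  obtain ⟨W, rfl, rfl⟩ := h₁
  obtain ⟨V, h, rfl⟩ := h₂
  simp only [altMap, id, Nat.reduceSub] at *
  simp only [dx, dz] at hA
  have e := congrArg d h
  simp only [dx, dy, dz] at e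
  obtain ⟨T, hT, rfl⟩ := hxy.two (z (x W)) V
    (by simp only [dx, dy, dz] at hA ⊢; omega) ‹_›
  have eT := congrArg d hT
  simp only [dx, dy, dz] at eT
  obtain ⟨S, hS, rfl⟩ := hzy.two (x W) T
    (by simp only [dx, dy, dz] at hA ⊢; omega) ‹_›
  have eS := congrArg d hS
  simp only [dx, dy, dz] at eS
  obtain ⟨U, rfl, rfl⟩ := hxy.two W S (by omega) ‹_›
  exact ⟨z (x (z U)),
    by simp only [altMap, id]; clear * - rxz rzy rxy; grind only,
    by simp only [altMap, id]; clear * - rxz rzy rxy; grind only⟩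

theorem cube_three_three_two (hz : ∀ A B, d A < n → z A = z B → A = B)
    (hxz : BraidBelow d n 3 x z) (hzy : BraidBelow d n 3 z y) (hxy : BraidBelow d n 2 x y)
    (hA : d A ≤ n) (h₁ : BraidJoin 3 x z A C) (h₂ : BraidJoin 3 z y C B) :
    BraidJoin 2 x y A B := by
  obtain ⟨dx, dz, rxz, -⟩ := id hxz
  obtain ⟨-, dy, rzy, -⟩ := id hzy
  obtain ⟨-, -, rxy, -⟩ := id hxy
  obtain ⟨W, rfl, rfl⟩ := h₁
  obtain ⟨V, h, rfl⟩ := h₂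
  simp only [altMap, id, Nat.reduceSub] at *
  simp only [dx, dz] at hA
  have e := congrArg d h
  simp only [dx, dy, dz] at e
  obtain ⟨T, hT, hT'⟩ := hxy.two (z W) (z V)
    (by simp only [dx, dy, dz] at hA ⊢; omega) ‹_›
  have eT := congrArg d hT
  simp only [dx, dy, dz] at eT
  have eT' := congrArg d hT'
  simp only [dx, dy, dz] at eT'
  obtain ⟨S, rfl, rfl⟩ := hzy.three W T (by omega) ‹_›
  obtain ⟨Q, hQ, rfl⟩ := hxz.three (z (y S)) V (by omega) (Eq.symm ‹_›)
  have eQ := congrArg d hQ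
  simp only [dx, dy, dz] at eQ
  -- `z V` now has two expressions, both starting with `z`, so cancellation is needed besides the
  -- joins.
  replace h := hz (y S) (x Q)
    (by simp only [dx, dy, dz] at hA ⊢; omega) ‹_›
  obtain ⟨U, rfl, rfl⟩ := hxy.two Q S
    (by simp only [dx, dy, dz] at hA ⊢; omega) (Eq.symm ‹_›)
  exact ⟨z (y (x (z U))),
    by simp only [altMap, id]; clear * - rxz rzy rxy; grind only,
    by simp only [altMap, id]; clear * - rxz rzy rxy; grind only⟩

theorem cube_three_two_three (hxz : BraidBelow d n 3 x z)
    (hzy : BraidBelow d n 2 z y) (hxy : BraidBelow d n 3 x y)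
    (hA : d A ≤ n) (h₁ : BraidJoin 3 x z A C) (h₂ : BraidJoin 2 z y C B) :
    BraidJoin 3 x y A B := by
  obtain ⟨dx, dz, rxz, -⟩ := id hxz
  obtain ⟨-, dy, rzy, -⟩ := id hzy
  obtain ⟨-, -, rxy, -⟩ := id hxy
  obtain ⟨W, rfl, rfl⟩ := h₁
  obtain ⟨V, h, rfl⟩ := h₂
  simp only [altMap, id, Nat.reduceSub] at *
  simp only [dx, dz] at hA
  have e := congrArg d h
  simp only [dx, dy, dz] at e
  obtain ⟨T, hT, rfl⟩ := hxy.three (z W) V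
    (by simp only [dx, dy, dz] at hA ⊢; omega) ‹_›
  have eT := congrArg d hT
  simp only [dx, dy, dz] at eT
  obtain ⟨S, rfl, hS⟩ := hzy.two W (x T) (by omega) ‹_›
  have eS' := congrArg d hS
  simp only [dx, dy, dz] at eS'
  obtain ⟨Q, rfl, rfl⟩ := hxz.three T S (by omega) ‹_›
  exact ⟨z (x (y Q)),
    by simp only [altMap, id]; clear * - rxz rzy rxy; grind only,
    by simp only [altMap, id]; clear * - rxz rzy rxy; grind only⟩

theorem cube_four_three_two (hx : ∀ A B, d A < n → x A = x B → A = B)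
    (hz : ∀ A B, d A < n → z A = z B → A = B)
    (hxz : BraidBelow d n 4 x z) (hzy : BraidBelow d n 3 z y) (hxy : BraidBelow d n 2 x y)
    (hA : d A ≤ n) (h₁ : BraidJoin 4 x z A C) (h₂ : BraidJoin 3 z y C B) :
    BraidJoin 2 x y A B := by
  obtain ⟨dx, dz, rxz, -⟩ := id hxz
  obtain ⟨-, dy, rzy, -⟩ := id hzy
  obtain ⟨-, -, rxy, -⟩ := id hxy
  obtain ⟨W, rfl, rfl⟩ := h₁
  obtain ⟨V, h, rfl⟩ := h₂
  simp only [altMap, id, Nat.reduceSub] at *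
  simp only [dx, dz] at hA
  have e := congrArg d h
  simp only [dx, dy, dz] at e
  obtain ⟨P, hP, hP'⟩ := hxy.two (z (x W)) (z V)
    (by simp only [dx, dy, dz] at hA ⊢; omega) ‹_›
  have eP := congrArg d hP
  simp only [dx, dy, dz] at eP
  have eP' := congrArg d hP'
  simp only [dx, dy, dz] at eP'
  obtain ⟨Q, hQ, rfl⟩ := hzy.three (x W) P
    (by simp only [dx, dy, dz] at hA ⊢; omega) ‹_›
  have eQ := congrArg d hQ
  simp only [dx, dy, dz] at eQ
  obtain ⟨R, rfl, hR⟩ := hxy.two W (z Q) (by omega) ‹_›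
  have eR' := congrArg d hR
  simp only [dx, dy, dz] at eR'
  obtain ⟨D, rfl, rfl⟩ := hxz.four R Q (by omega) (Eq.symm ‹_›)
  obtain ⟨F, hF, rfl⟩ := hxz.four (z (y (x (z (x D))))) V (by omega) (Eq.symm ‹_›)
  have eF := congrArg d hF
  simp only [dx, dy, dz] at eF
  replace h := hz (y (x (z (x D)))) (x (z F))
    (by simp only [dx, dy, dz] at hA ⊢; omega) ‹_›
  -- Commuting `x` to the front exposes a letter that can be cancelled.
  rw [← rxy] at h
  replace h := hx (y (z (x D))) (z F)
    (by simp only [dx, dy, dz] at hA ⊢; omega) ‹_›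
  obtain ⟨G, rfl, hG⟩ := hzy.three F (z (x D))
    (by simp only [dx, dy, dz] at hA ⊢; omega) (Eq.symm ‹_›)
  have eG' := congrArg d hG
  simp only [dx, dy, dz] at eG'
  replace h := hz (x D) (y G)
    (by simp only [dx, dy, dz] at hA ⊢; omega) ‹_›
  obtain ⟨H, rfl, rfl⟩ := hxy.two D G
    (by simp only [dx, dy, dz] at hA ⊢; omega) ‹_›
  -- Seven letters, preceded by `x y`, make the nine letters of the longest word of type `B₃`.
  exact ⟨z (y (x (z (x (y (z H)))))),
    by simp only [altMap, id]; clear * - rxz rzy rxy; grind only,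
    by simp only [altMap, id]; clear * - rxz rzy rxy; grind only⟩

theorem cube_four_two_three (hx : ∀ A B, d A < n → x A = x B → A = B)
    (hxz : BraidBelow d n 4 x z) (hzy : BraidBelow d n 2 z y) (hxy : BraidBelow d n 3 x y)
    (hA : d A ≤ n) (h₁ : BraidJoin 4 x z A C) (h₂ : BraidJoin 2 z y C B) :
    BraidJoin 3 x y A B := by
  obtain ⟨dx, dz, rxz, -⟩ := id hxz
  obtain ⟨-, dy, rzy, -⟩ := id hzy
  obtain ⟨-, -, rxy, -⟩ := id hxy
  obtain ⟨W, rfl, rfl⟩ := h₁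
  obtain ⟨V, h, rfl⟩ := h₂
  simp only [altMap, id, Nat.reduceSub] at *
  simp only [dx, dz] at hA
  have e := congrArg d h
  simp only [dx, dy, dz] at e
  obtain ⟨T, hT, rfl⟩ := hxy.three (z (x W)) V
    (by simp only [dx, dy, dz] at hA ⊢; omega) ‹_›
  have eT := congrArg d hT
  simp only [dx, dy, dz] at eT
  obtain ⟨S, hS, hS'⟩ := hzy.two (x W) (x T)
    (by simp only [dx, dy, dz] at hA ⊢; omega) ‹_›
  have eS := congrArg d hS
  simp only [dx, dy, dz] at eS
  have eS' := congrArg d hS'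
  simp only [dx, dy, dz] at eS'
  obtain ⟨Q, rfl, rfl⟩ := hxy.three W S (by omega) ‹_›
  obtain ⟨P, rfl, hP⟩ := hxz.four T (x (y Q)) (by omega) ‹_›
  have eP' := congrArg d hP
  simp only [dx, dy, dz] at eP'
  replace h := hx (y Q) (z (x P))
    (by simp only [dx, dy, dz] at hA ⊢; omega) ‹_›
  obtain ⟨R, hR, rfl⟩ := hzy.two (x P) Q
    (by simp only [dx, dy, dz] at hA ⊢; omega) (Eq.symm ‹_›)
  have eR := congrArg d hR
  simp only [dx, dy, dz] at eR
  obtain ⟨U, rfl, rfl⟩ := hxy.three P R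
    (by simp only [dx, dy, dz] at hA ⊢; omega) ‹_›
  exact ⟨z (x (y (z (x (z U))))),
    by simp only [altMap, id]; clear * - rxz rzy rxy; grind only,
    by simp only [altMap, id]; clear * - rxz rzy rxy; grind only⟩

theorem cube_three_two_four (hxz : BraidBelow d n 3 x z)
    (hzy : BraidBelow d n 2 z y) (hxy : BraidBelow d n 4 x y)
    (hA : d A ≤ n) (h₁ : BraidJoin 3 x z A C) (h₂ : BraidJoin 2 z y C B) :
    BraidJoin 4 x y A B := by
  obtain ⟨dx, dz, rxz, -⟩ := id hxz
  obtain ⟨-, dy, rzy, -⟩ := id hzy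
  obtain ⟨-, -, rxy, -⟩ := id hxy
  obtain ⟨W, rfl, rfl⟩ := h₁
  obtain ⟨V, h, rfl⟩ := h₂
  simp only [altMap, id, Nat.reduceSub] at *
  simp only [dx, dz] at hA
  have e := congrArg d h
  simp only [dx, dy, dz] at e
  obtain ⟨T, hT, rfl⟩ := hxy.four (z W) V
    (by simp only [dx, dy, dz] at hA ⊢; omega) ‹_›
  have eT := congrArg d hT
  simp only [dx, dy, dz] at eT
  obtain ⟨S, rfl, hS⟩ := hzy.two W (x (y T)) (by omega) ‹_›
  have eS' := congrArg d hS
  simp only [dx, dy, dz] at eS'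
  obtain ⟨Q, hQ, rfl⟩ := hxz.three (y T) S
    (by simp only [dx, dy, dz] at hA ⊢; omega) ‹_›
  have eQ := congrArg d hQ
  simp only [dx, dy, dz] at eQ
  obtain ⟨P, hP, rfl⟩ := hzy.two (x Q) T
    (by simp only [dx, dy, dz] at hA ⊢; omega) (Eq.symm ‹_›)
  have eP := congrArg d hP
  simp only [dx, dy, dz] at eP
  obtain ⟨R, rfl, rfl⟩ := hxy.four Q P (by omega) ‹_›
  exact ⟨z (x (y (x (z R)))),
    by simp only [altMap, id]; clear * - rxz rzy rxy; grind only,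
    by simp only [altMap, id]; clear * - rxz rzy rxy; grind only⟩

/-- The label conditions leave sixteen triples. Exchanging `x` and `y` swaps `a` and `b`, which
reduces them to the ten cases above. -/
theorem BraidJoin.trans {a b c : ℕ} (ha : a = 2 ∨ a = 3 ∨ a = 4) (hb : b = 2 ∨ b = 3 ∨ b = 4)
    (hc : c = 2 ∨ c = 3 ∨ c = 4) (h : a = 2 ∨ b = 2 ∨ c = 2) (hab : ¬(a = 4 ∧ b = 4))
    (hbc : ¬(b = 4 ∧ c = 4)) (hac : ¬(a = 4 ∧ c = 4))
    (hx : ∀ A B, d A < n → x A = x B → A = B) (hy : ∀ A B, d A < n → y A = y B → A = B)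
    (hz : ∀ A B, d A < n → z A = z B → A = B)
    (hxz : BraidBelow d n a x z) (hzy : BraidBelow d n b z y) (hxy : BraidBelow d n c x y)
    (hA : d A ≤ n) (hB : d B ≤ n) (h₁ : BraidJoin a x z A C) (h₂ : BraidJoin b z y C B) :
    BraidJoin c x y A B := by
  rcases ha with rfl | rfl | rfl <;> rcases hb with rfl | rfl | rfl <;>
    rcases hc with rfl | rfl | rfl <;> try omega
  · exact cube_two_two_two hxz hzy hxy hA h₁ h₂
  · exact cube_two_two_three hxz hzy hxy hA h₁ h₂
  · exact cube_two_two_four hxz hzy hxy hA h₁ h₂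
  · exact (cube_three_two_two hzy.symm hxz.symm hxy.symm hB h₂.symm h₁.symm).symm
  · exact (cube_three_two_three hzy.symm hxz.symm hxy.symm hB h₂.symm h₁.symm).symm
  · exact (cube_three_two_four hzy.symm hxz.symm hxy.symm hB h₂.symm h₁.symm).symm
  · exact (cube_four_two_two hzy.symm hxz.symm hxy.symm hB h₂.symm h₁.symm).symm
  · exact (cube_four_two_three hy hzy.symm hxz.symm hxy.symm hB h₂.symm h₁.symm).symm
  · exact cube_three_two_two hxz hzy hxy hA h₁ h₂
  · exact cube_three_two_three hxz hzy hxy hA h₁ h₂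
  · exact cube_three_two_four hxz hzy hxy hA h₁ h₂
  · exact cube_three_three_two hz hxz hzy hxy hA h₁ h₂
  · exact (cube_four_three_two hy hz hzy.symm hxz.symm hxy.symm hB h₂.symm h₁.symm).symm
  · exact cube_four_two_two hxz hzy hxy hA h₁ h₂
  · exact cube_four_two_three hx hxz hzy hxy hA h₁ h₂
  · exact cube_four_three_two hx hz hxz hzy hxy hA h₁ h₂

end Cube

/-! ### The reduction property of the Artin monoid -/

namespace ArtinMonoid

variable {I : Type*} (M : CoxeterMatrix I)

/-- Left multiplication by the letter `a_i`. -/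
def mulLetter (i : I) (A : ArtinMonoid M) : ArtinMonoid M := letter M i * A

theorem deg_mul (u v : ArtinMonoid M) : deg M (u * v) = deg M u + deg M v := by
  simp [deg]

theorem deg_one : deg M 1 = 0 := by simp [deg]

theorem deg_letter (i : I) : deg M (letter M i) = 1 := by
  simp [deg, degHom, letter]

theorem deg_mulLetter (i : I) (A : ArtinMonoid M) : deg M (mulLetter M i A) = deg M A + 1 := by
  rw [mulLetter, deg_mul, deg_letter, add_comm]

/-- The class of a word. -/
def ofWord (u : List I) : ArtinMonoid M := PresentedMonoid.mk (Rel M) (FreeMonoid.ofList u)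

theorem ofWord_cons (i : I) (u : List I) : ofWord M (i :: u) = mulLetter M i (ofWord M u) := rfl

theorem ofWord_append (u v : List I) : ofWord M (u ++ v) = ofWord M u * ofWord M v := rfl

theorem exists_ofWord (A : ArtinMonoid M) : ∃ u, A = ofWord M u := by
  obtain ⟨u, rfl⟩ := PresentedMonoid.surjective_mk A
  exact ⟨u.toList, rfl⟩

theorem deg_ofWord (u : List I) : deg M (ofWord M u) = u.length := by
  induction u with
  | nil => exact deg_one M
  | cons i u ih => rw [ofWord_cons, deg_mulLetter, ih, List.length_cons]

theorem altMap_mul (i j : I) (m : ℕ) (A B : ArtinMonoid M) :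
    altMap (mulLetter M i) (mulLetter M j) m A * B =
      altMap (mulLetter M i) (mulLetter M j) m (A * B) := by
  induction m generalizing i j with
  | zero => rfl
  | succ m ih => simp only [altMap, ← ih, mulLetter, mul_assoc]

theorem braidJoin_mul {m : ℕ} {i j : I} {A B : ArtinMonoid M}
    (h : BraidJoin m (mulLetter M i) (mulLetter M j) A B) (C : ArtinMonoid M) :
    BraidJoin m (mulLetter M i) (mulLetter M j) (A * C) (B * C) := by
  obtain ⟨W, rfl, rfl⟩ := h
  exact ⟨W * C, altMap_mul .., altMap_mul ..⟩

theorem ofWord_alternatingWord_mul (i j : I) (m : ℕ) (A : ArtinMonoid M) :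
    ofWord M (CoxeterSystem.alternatingWord i j m) * A =
      if Even m then altMap (mulLetter M i) (mulLetter M j) m A
      else altMap (mulLetter M j) (mulLetter M i) m A := by
  induction m with
  | zero => exact one_mul A
  | succ m ih =>
    rw [CoxeterSystem.alternatingWord_succ', ofWord_cons, mulLetter, mul_assoc, ih]
    by_cases hm : Even m <;> simp [hm, Nat.even_add_one, altMap, mulLetter]

theorem ofWord_alternatingWord (i j : I) (m : ℕ) :
    ofWord M (CoxeterSystem.alternatingWord i j m) =
      if Even m then altMap (mulLetter M i) (mulLetter M j) m 1
      else altMap (mulLetter M j) (mulLetter M i) m 1 := by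
  rw [← ofWord_alternatingWord_mul, mul_one]

theorem altMap_braid (i j : I) (A : ArtinMonoid M) :
    altMap (mulLetter M i) (mulLetter M j) (M i j) A =
      altMap (mulLetter M j) (mulLetter M i) (M i j) A := by
  have h : ofWord M (CoxeterSystem.alternatingWord i j (M i j)) * A =
      ofWord M (CoxeterSystem.alternatingWord j i (M i j)) * A :=
    congrArg (· * A) (PresentedMonoid.mk_eq_mk_of_rel (Rel.braid i j))
  rw [ofWord_alternatingWord_mul, ofWord_alternatingWord_mul] at h
  split_ifs at h
  · exact h
  · exact h.symm

/-- The rank three parabolic subsystems of `M` are among those of types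
`A₁³`, `A₁ × A₂`, `A₁ × B₂`, `A₃` and `B₃`. -/
structure IsSmall : Prop where
  entry : ∀ i j, i ≠ j → M i j = 2 ∨ M i j = 3 ∨ M i j = 4
  two : ∀ i j k, i ≠ j → i ≠ k → j ≠ k → M i k = 2 ∨ M k j = 2 ∨ M i j = 2
  four : ∀ i j k, i ≠ j → i ≠ k → j ≠ k → ¬(M i j = 4 ∧ M i k = 4)

variable {M}

/-- As the diagonal entries of a Coxeter matrix are 1, left cancellation is the case `i = j` of the
reduction property, and one induction proves both. -/
theorem braidJoin_one_iff {α : Type*} {x y : α → α} {A B : α} : BraidJoin 1 x y A B ↔ A = B := by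
  simp [BraidJoin, altMap, eq_comm]

theorem altMap_cancel {n : ℕ} {i j : I}
    (hi : ∀ A B, deg M A < n → mulLetter M i A = mulLetter M i B → A = B)
    (hj : ∀ A B, deg M A < n → mulLetter M j A = mulLetter M j B → A = B) {m : ℕ}
    {A B : ArtinMonoid M} (hA : deg M (altMap (mulLetter M i) (mulLetter M j) m A) ≤ n)
    (h : altMap (mulLetter M i) (mulLetter M j) m A =
      altMap (mulLetter M i) (mulLetter M j) m B) : A = B := by
  induction m generalizing i j with
  | zero => exact h
  | succ m ih =>
    rw [altMap, deg_mulLetter] at hA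
    exact ih hj hi (by omega) (hi _ _ (by omega) h)

/-- The induction runs over the generation of the congruence. Words of length at most `n + 1` have
tails of degree at most `n`, while `ih` covers degrees below `n`; the gap is closed because every
use of `ih` comes after at least one letter of a tail has been stripped. -/
theorem join_of_conGen (hM : IsSmall M) {n : ℕ}
    (ih : ∀ i j, BraidBelow (deg M) n (M i j) (mulLetter M i) (mulLetter M j))
    {u v : FreeMonoid I} (h : ConGen.Rel (Rel M) u v) :
    u.toList.length ≤ n + 1 → ∀ i j X Y, u.toList = i :: X → v.toList = j :: Y →
      BraidJoin (M i j) (mulLetter M i) (mulLetter M j) (ofWord M X) (ofWord M Y) := by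
  have cancel (i : I) (A B : ArtinMonoid M) (hA : deg M A < n)
      (e : mulLetter M i A = mulLetter M i B) : A = B := by
    have := (ih i i).join A B hA e
    rwa [M.diagonal, braidJoin_one_iff] at this
  have len {u v : FreeMonoid I} (h : ConGen.Rel (Rel M) u v) :
      u.toList.length = v.toList.length := by
    rw [← deg_ofWord M, ← deg_ofWord M]
    exact congrArg (deg M) (PresentedMonoid.mk_eq_mk_iff.2 h)
  induction h with
  | of u v h =>
    obtain ⟨i, j⟩ := h
    intro _ p q X Y hp hq
    rw [FreeMonoid.toList_ofList] at hp hq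
    rcases hm : M i j with _ | k
    · simp [hm, CoxeterSystem.alternatingWord] at hp
    · rw [hm, CoxeterSystem.alternatingWord_succ', List.cons.injEq] at hp hq
      obtain ⟨rfl, rfl⟩ := hp
      obtain ⟨rfl, rfl⟩ := hq
      rw [ofWord_alternatingWord, ofWord_alternatingWord]
      -- `alternatingWord` fixes the last letter, so the first one depends on parity. A defining
      -- relation is itself a join with witness 1.
      by_cases hk : Even k
      · simp only [hk, if_true]
        rw [M.symmetric, hm]
        exact ⟨1, rfl, rfl⟩
      · simp only [hk, if_false]
        rw [hm]
        exact ⟨1, rfl, rfl⟩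
  | refl u =>
    intro _ i j X Y hi hj
    rw [hi, List.cons.injEq] at hj
    obtain ⟨rfl, rfl⟩ := hj
    rw [M.diagonal, braidJoin_one_iff]
  | symm h ih' =>
    intro hl i j X Y hi hj
    rw [M.symmetric]
    exact (ih' (by rwa [len h]) j i Y X hj hi).symm
  | @trans u w v h₁ h₂ ih₁ ih₂ =>
    intro hl i j X Y hi hj
    have e₁ := len h₁
    have e₂ := len h₂
    rcases hw : w.toList with _ | ⟨k, Z⟩
    · simp [hi, hw] at e₁
    have j₁ := ih₁ hl i k X Z hi hw
    have j₂ := ih₂ (by omega) k j Z Y hw hj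
    have hX : deg M (ofWord M X) ≤ n := by
      rw [deg_ofWord]; simpa [hi] using hl
    have hY : deg M (ofWord M Y) ≤ n := by
      rw [deg_ofWord]; rw [e₁, e₂, hj] at hl; simpa using hl
    have hZ : deg M (ofWord M Z) ≤ n := by
      rw [deg_ofWord]; rw [e₁, hw] at hl; simpa using hl
    by_cases hik : i = k
    · subst hik
      rw [M.diagonal, braidJoin_one_iff] at j₁
      rwa [j₁]
    by_cases hkj : k = j
    · subst hkj
      rw [M.diagonal, braidJoin_one_iff] at j₂
      rwa [← j₂]
    by_cases hij : i = j
    · subst hij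
      rw [M.diagonal, braidJoin_one_iff]
      rw [M.symmetric] at j₂
      obtain ⟨W, hXW, hZW⟩ := j₁
      obtain ⟨V, hZV, hYV⟩ := j₂
      -- `Z` is the same alternating word applied to `W` and to `V`; that word is cancelled letter
      -- by letter.
      suffices W = V by rw [hXW, hYV, this]
      rw [hZW] at hZV hZ
      exact altMap_cancel (cancel _) (cancel _) hZ hZV
    exact BraidJoin.trans (hM.entry i k hik) (hM.entry k j hkj) (hM.entry i j hij)
      (hM.two i j k hij hik (Ne.symm hkj))
      (by rw [M.symmetric i k]; exact hM.four k i j (Ne.symm hik) hkj hij)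
      (by rw [M.symmetric k j, M.symmetric i j]
          exact hM.four j k i (Ne.symm hkj) (Ne.symm hij) (Ne.symm hik))
      (hM.four i k j hik hij hkj)
      (cancel i) (cancel j) (cancel k) (ih i k) (ih k j) (ih i j) hX hY j₁ j₂
  | @mul u u' v v' h₁ h₂ ih₁ ih₂ =>
    intro hl i j X Y hi hj
    rw [FreeMonoid.toList_mul] at hl hi hj
    have e₁ := len h₁
    have e₂ : ofWord M v.toList = ofWord M v'.toList := PresentedMonoid.mk_eq_mk_iff.2 h₂
    rw [List.length_append] at hl
    rcases hu : u.toList with _ | ⟨p, P⟩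
    · rcases hu' : u'.toList with _ | ⟨q, Q⟩
      · rw [hu, List.nil_append] at hi
        rw [hu', List.nil_append] at hj
        exact ih₂ (by omega) i j X Y hi hj
      · simp [hu, hu'] at e₁
    · rcases hu' : u'.toList with _ | ⟨q, Q⟩
      · simp [hu, hu'] at e₁
      · rw [hu, List.cons_append, List.cons.injEq] at hi
        rw [hu', List.cons_append, List.cons.injEq] at hj
        obtain ⟨rfl, rfl⟩ := hi
        obtain ⟨rfl, rfl⟩ := hj
        rw [ofWord_append, ofWord_append, e₂]
        -- The first letters lie in the left factors, and the right factors represent the same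
        -- element, so the join of the left tails is multiplied by it.
        exact braidJoin_mul M (ih₁ (by omega) p q P Q hu hu') _

theorem join_of_mul_eq (hM : IsSmall M) (n : ℕ) (i j : I) (A B : ArtinMonoid M) (hA : deg M A < n)
    (h : mulLetter M i A = mulLetter M j B) :
    BraidJoin (M i j) (mulLetter M i) (mulLetter M j) A B := by
  induction n generalizing i j A B with
  | zero => omega
  | succ n ih =>
    obtain ⟨X, rfl⟩ := exists_ofWord M A
    obtain ⟨Y, rfl⟩ := exists_ofWord M B
    rw [← ofWord_cons, ← ofWord_cons] at h
    refine join_of_conGen hM (n := n) (fun i j => ⟨deg_mulLetter M i, deg_mulLetter M j,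
      altMap_braid M i j, fun A B hA e => ih i j A B hA e⟩) (PresentedMonoid.mk_eq_mk_iff.1 h)
      ?_ i j X Y rfl rfl
    rw [deg_ofWord] at hA
    simpa using hA

end ArtinMonoid

/-! ### Least common multiples along a chain -/

/-- The elements `a 0, …, a (l - 1)` of a monoid satisfy the braid relations of the chain with `l`
vertices, whose first edge carries the label `4` if `e` holds and whose other edges carry the label
`3`; they are left cancellable, and common multiples of two of them come from these relations. -/
structure IsBraidChain {G : Type*} [Monoid G] (a : ℕ → G) (l : ℕ) (e : Prop) : Prop where
  cancel : ∀ i, i < l → ∀ X Y, a i * X = a i * Y → X = Y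
  comm : ∀ i j, j + 1 < i → i < l → a i * a j = a j * a i
  comm_dvd : ∀ i j X, j + 1 < i → i < l → a i ∣ a j * X → a i ∣ X
  braid : ∀ i, i + 1 < l → (i = 0 → ¬e) → a (i + 1) * (a i * a (i + 1)) = a i * (a (i + 1) * a i)
  braid_dvd : ∀ i X, i + 1 < l → (i = 0 → ¬e) → a (i + 1) ∣ a i * X → a (i + 1) * a i ∣ X
  four : e → 1 < l → a 1 * (a 0 * (a 1 * a 0)) = a 0 * (a 1 * (a 0 * a 1))
  four_dvd : ∀ X, e → 1 < l → a 1 ∣ a 0 * X → a 1 * (a 0 * a 1) ∣ X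

section Chain

variable {G : Type*} [Monoid G]

open Classical in
/-- The factor by which the right lcm of the `a i`, `i ∈ J`, `i < n`, has to be multiplied in order
to become divisible by `a n`. -/
def chainTail (a : ℕ → G) (e : Prop) (J : Finset ℕ) : ℕ → G
  | 0 => a 0
  | n + 1 =>
    if n ∈ J then
      if e ∧ Finset.range (n + 1) ⊆ J then a (n + 1) * (chainTail a e J n * a (n + 1))
      else a (n + 1) * chainTail a e J n
    else a (n + 1)

/-- The right lcm of the `a i` with `i ∈ J` and `i < n`. -/
def chainLcm (a : ℕ → G) (e : Prop) (J : Finset ℕ) : ℕ → G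
  | 0 => 1
  | n + 1 => if n ∈ J then chainLcm a e J n * chainTail a e J n else chainLcm a e J n

open Submonoid

variable {a : ℕ → G} {l : ℕ} {e : Prop} {J : Finset ℕ}

theorem chainTail_mem_closure (n : ℕ) : chainTail a e J n ∈ closure (a '' Set.Iio (n + 1)) := by
  induction n with
  | zero => exact subset_closure ⟨0, by simp, rfl⟩
  | succ n ih =>
    have h₁ : a (n + 1) ∈ closure (a '' Set.Iio (n + 1 + 1)) := subset_closure ⟨n + 1, by simp, rfl⟩
    have h₂ := closure_mono (Set.image_mono (Set.Iio_subset_Iio (Nat.le_succ (n + 1)))) ih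
    rw [chainTail]
    split_ifs
    · exact mul_mem h₁ (mul_mem h₂ h₁)
    · exact mul_mem h₁ h₂
    · exact h₁

theorem chainLcm_mem_closure (n : ℕ) : chainLcm a e J n ∈ closure (a '' Set.Iio n) := by
  induction n with
  | zero => exact one_mem _
  | succ n ih =>
    have h := closure_mono (Set.image_mono (Set.Iio_subset_Iio (Nat.le_succ n))) ih
    rw [chainLcm]
    split_ifs
    · exact mul_mem h (chainTail_mem_closure n)
    · exact h

namespace IsBraidChain

variable (ha : IsBraidChain a l e)
include ha

theorem letter_mul_comm {n i : ℕ} (hn : n < i) (hi : i < l) {S : G}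
    (hS : S ∈ closure (a '' Set.Iio n)) : a i * S = S * a i := by
  induction hS using closure_induction with
  | mem S hS =>
    obtain ⟨j, hj, rfl⟩ := hS
    exact ha.comm i j (by have : j < n := hj; omega) hi
  | one => simp
  | mul S T _ _ hS hT => rw [← mul_assoc, hS, mul_assoc, hT, mul_assoc]

theorem letter_dvd_of_dvd_mul {n i : ℕ} (hn : n < i) (hi : i < l) {S : G}
    (hS : S ∈ closure (a '' Set.Iio n)) : ∀ X, a i ∣ S * X → a i ∣ X := by
  induction hS using closure_induction with
  | mem S hS =>
    obtain ⟨j, hj, rfl⟩ := hS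
    exact fun X => ha.comm_dvd i j X (by have : j < n := hj; omega) hi
  | one => simp
  | mul S T _ _ hS hT =>
    intro X h
    rw [mul_assoc] at h
    exact hT _ (hS _ h)

theorem letter_dvd_mul_iff {n i : ℕ} (hn : n < i) (hi : i < l) {S : G}
    (hS : S ∈ closure (a '' Set.Iio n)) (X : G) : a i ∣ S * X ↔ a i ∣ X := by
  refine ⟨ha.letter_dvd_of_dvd_mul hn hi hS X, ?_⟩
  rintro ⟨Y, rfl⟩
  rw [← mul_assoc, ← ha.letter_mul_comm hn hi hS, mul_assoc]
  exact dvd_mul_right _ _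

/-- `S` involves only letters that commute with `a i`, so `a i` passes through `S` and can be
cancelled. -/
theorem letter_mul_dvd_mul_iff {n i : ℕ} (hn : n < i) (hi : i < l) {S : G}
    (hS : S ∈ closure (a '' Set.Iio n)) (T X : G) :
    a i * T ∣ S * X ↔ ∃ Y, X = a i * Y ∧ T ∣ S * Y := by
  constructor
  · intro h
    obtain ⟨Y, rfl⟩ := ha.letter_dvd_of_dvd_mul hn hi hS X (dvd_of_mul_right_dvd h)
    refine ⟨Y, rfl, ?_⟩
    obtain ⟨Z, hZ⟩ := h
    rw [← mul_assoc, ← ha.letter_mul_comm hn hi hS, mul_assoc, mul_assoc] at hZ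
    exact ⟨Z, ha.cancel i hi _ _ hZ⟩
  · rintro ⟨Y, rfl, Z, hZ⟩
    refine ⟨Z, ?_⟩
    rw [← mul_assoc, ← ha.letter_mul_comm hn hi hS, mul_assoc, hZ, mul_assoc]

theorem braid_dvd_iff {i : ℕ} (hi : i + 1 < l) (he : i = 0 → ¬e) (X : G) :
    a (i + 1) ∣ a i * X ↔ a (i + 1) * a i ∣ X := by
  refine ⟨ha.braid_dvd i X hi he, ?_⟩
  rintro ⟨Y, rfl⟩
  refine ⟨a i * a (i + 1) * Y, ?_⟩
  have := congrArg (· * Y) (ha.braid i hi he)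
  simpa only [mul_assoc] using this.symm

theorem four_dvd_iff (he : e) (hl : 1 < l) (X : G) :
    a 1 ∣ a 0 * X ↔ a 1 * (a 0 * a 1) ∣ X := by
  refine ⟨ha.four_dvd X he hl, ?_⟩
  rintro ⟨Y, rfl⟩
  refine ⟨a 0 * (a 1 * (a 0 * Y)), ?_⟩
  have := congrArg (· * Y) (ha.four he hl)
  simpa only [mul_assoc] using this.symm

/-- The tail at `n` starts with `a n`, which is handled by the braid relation with `a (n + 1)`. For
`n > 0` the shorter tail inside it commutes with `a (n + 1)`, and the remaining divisibility is the
induction hypothesis. -/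
theorem letter_dvd_chainTail_mul_iff {n : ℕ} (hn : n + 1 < l) (hJ : n ∈ J) (X : G) :
    a (n + 1) ∣ chainTail a e J n * X ↔ chainTail a e J (n + 1) ∣ X := by
  induction n generalizing X with
  | zero =>
    by_cases he : e
    · simp only [chainTail, hJ, he, if_true, zero_add, Finset.range_one,
        Finset.singleton_subset_iff, and_self]
      exact ha.four_dvd_iff he hn X
    · simp only [chainTail, hJ, he, if_true, if_false, zero_add, false_and]
      exact ha.braid_dvd_iff hn (fun _ => he) X
  | succ k ih =>
    have hmem := chainTail_mem_closure (a := a) (e := e) (J := J) k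
    have hb := ha.braid_dvd_iff (i := k + 1) hn (by simp)
    by_cases hk : k ∈ J
    · have IH := ih (by omega) hk
      have hsub : Finset.range (k + 1 + 1) ⊆ J ↔ Finset.range (k + 1) ⊆ J := by
        rw [Finset.range_add_one (n := k + 1), Finset.insert_subset_iff, and_iff_right hJ]
      by_cases hf : e ∧ Finset.range (k + 1) ⊆ J
      · have ht : chainTail a e J (k + 1) = a (k + 1) * (chainTail a e J k * a (k + 1)) := by
          rw [chainTail, if_pos hk, if_pos hf]
        have ht' : chainTail a e J (k + 1 + 1) =
            a (k + 1 + 1) * (chainTail a e J (k + 1) * a (k + 1 + 1)) := by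
          rw [chainTail, if_pos hJ, if_pos ⟨hf.1, hsub.2 hf.2⟩]
        have hc (Z : G) : a (k + 1 + 1) * (chainTail a e J k * Z) =
            chainTail a e J k * (a (k + 1 + 1) * Z) := by
          rw [← mul_assoc, ha.letter_mul_comm (Nat.lt_succ_self (k + 1)) hn hmem, mul_assoc]
        have hbr (Z : G) : a (k + 1 + 1) * (a (k + 1) * (a (k + 1 + 1) * Z)) =
            a (k + 1) * (a (k + 1 + 1) * (a (k + 1) * Z)) := by
          simpa only [mul_assoc] using congrArg (· * Z) (ha.braid (k + 1) hn (by simp))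
        rw [ht', ht]
        simp only [mul_assoc]
        rw [hb, ha.letter_mul_dvd_mul_iff (Nat.lt_succ_self (k + 1)) hn hmem]
        simp only [IH, ht]
        constructor
        -- The tail also ends with `a (k + 1)`, so the braid relation is used a second time, on `Q`,
        -- to produce the closing letter `a (k + 2)` of the longer palindrome.
        · rintro ⟨Y, hY, Q, rfl⟩
          obtain ⟨Z, rfl⟩ := (hb X).1 ⟨_, hY⟩
          simp only [mul_assoc] at hY ⊢
          rw [← hbr] at hY
          have hZ := ha.cancel (k + 1) (by omega) _ _ (ha.cancel _ hn _ _ hY)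
          obtain ⟨R, rfl⟩ := (hb Q).1
            ((ha.letter_dvd_mul_iff (Nat.lt_succ_self (k + 1)) hn hmem _).1 ⟨Z, hZ.symm⟩)
          simp only [mul_assoc] at hZ
          rw [← hbr, ← hc] at hZ
          rw [ha.cancel _ hn _ _ hZ]
          exact ⟨R, by simp only [mul_assoc]⟩
        · rintro ⟨Z, rfl⟩
          refine ⟨a (k + 1) * (a (k + 1 + 1) * (chainTail a e J k * (a (k + 1) *
            (a (k + 1 + 1) * Z)))), ?_, a (k + 1 + 1) * (a (k + 1) * Z), ?_⟩
          · simp only [mul_assoc, hbr]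
          · simp only [mul_assoc, hbr, hc]
      · have ht : chainTail a e J (k + 1) = a (k + 1) * chainTail a e J k := by
          rw [chainTail, if_pos hk, if_neg hf]
        have ht' : chainTail a e J (k + 1 + 1) = a (k + 1 + 1) * chainTail a e J (k + 1) := by
          rw [chainTail, if_pos hJ, if_neg (fun h => hf ⟨h.1, hsub.1 h.2⟩)]
        rw [ht', ht, mul_assoc, hb,
          ha.letter_mul_dvd_mul_iff (Nat.lt_succ_self (k + 1)) hn hmem]
        simp only [IH, ht]
        constructor
        · rintro ⟨Y, rfl, h⟩
          exact mul_dvd_mul_left _ h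
        · rintro ⟨Y, rfl⟩
          exact ⟨_, mul_assoc .., dvd_mul_right _ _⟩
    · have hsub : ¬Finset.range (k + 1 + 1) ⊆ J := fun h => hk (h (by simp))
      simp only [chainTail, hk, hJ, if_true, if_false, hsub, and_false]
      exact hb X

theorem letter_dvd_chainLcm_mul_iff {n : ℕ} (hn : n < l) (X : G) :
    a n ∣ chainLcm a e J n * X ↔ chainTail a e J n ∣ X := by
  obtain _ | n := n
  · rw [chainLcm, chainTail, one_mul]
  · have hmem := chainLcm_mem_closure (a := a) (e := e) (J := J) n
    by_cases hJ : n ∈ J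
    · rw [chainLcm, if_pos hJ, mul_assoc, ha.letter_dvd_mul_iff (Nat.lt_succ_self n) hn hmem,
        ha.letter_dvd_chainTail_mul_iff hn hJ]
    · rw [chainLcm, if_neg hJ, chainTail, if_neg hJ,
        ha.letter_dvd_mul_iff (Nat.lt_succ_self n) hn hmem]

theorem letter_dvd_chainLcm {n : ℕ} (hn : n ≤ l) {i : ℕ} (hi : i ∈ J) (hin : i < n) :
    a i ∣ chainLcm a e J n := by
  induction n with
  | zero => omega
  | succ n ih =>
    rw [chainLcm]
    obtain rfl | hin := Nat.eq_or_lt_of_le (Nat.le_of_lt_succ hin)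
    · rw [if_pos hi, ha.letter_dvd_chainLcm_mul_iff hn]
    · split_ifs
      · exact (ih (by omega) hin).mul_right _
      · exact ih (by omega) hin

theorem chainLcm_dvd {n : ℕ} (hn : n ≤ l) {E : G} (hE : ∀ i ∈ J, i < n → a i ∣ E) :
    chainLcm a e J n ∣ E := by
  induction n with
  | zero => exact one_dvd E
  | succ n ih =>
    obtain ⟨X, rfl⟩ := ih (by omega) (fun i hi hin => hE i hi (by omega))
    rw [chainLcm]
    split_ifs with h
    · exact mul_dvd_mul_left _ ((ha.letter_dvd_chainLcm_mul_iff hn X).1 (hE n h (by omega)))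
    · exact dvd_mul_right _ _

end IsBraidChain

end Chain

/-! ### Alternating sums of degrees -/

section ChainDegree

open Classical in
/-- The degree of `chainTail a e J n`. -/
def chainTailDeg (e : Prop) (J : Finset ℕ) : ℕ → ℕ
  | 0 => 1
  | n + 1 =>
    if n ∈ J then
      chainTailDeg e J n + 1 + if e ∧ Finset.range (n + 1) ⊆ J then 1 else 0
    else 1

/-- The degree of `chainLcm a e J n`. -/
def chainLcmDeg (e : Prop) (J : Finset ℕ) : ℕ → ℕ
  | 0 => 0
  | n + 1 => if n ∈ J then chainLcmDeg e J n + chainTailDeg e J n else chainLcmDeg e J n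

section

variable {G : Type*} [Monoid G] {a : ℕ → G} {l : ℕ} {d : G → ℕ}

theorem deg_chainTail (d_mul : ∀ u v, d (u * v) = d u + d v) (d_a : ∀ i < l, d (a i) = 1)
    (e : Prop) (J : Finset ℕ) {n : ℕ} (hn : n < l) :
    d (chainTail a e J n) = chainTailDeg e J n := by
  induction n with
  | zero => exact d_a 0 hn
  | succ n ih =>
    rw [chainTail, chainTailDeg]
    split_ifs
    · rw [d_mul, d_mul, d_a _ hn, ih (by omega)]; omega
    · rw [d_mul, d_a _ hn, ih (by omega)]; omega
    · exact d_a _ hn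

theorem deg_chainLcm (d_one : d 1 = 0) (d_mul : ∀ u v, d (u * v) = d u + d v)
    (d_a : ∀ i < l, d (a i) = 1) (e : Prop) (J : Finset ℕ) {n : ℕ} (hn : n ≤ l) :
    d (chainLcm a e J n) = chainLcmDeg e J n := by
  induction n with
  | zero => exact d_one
  | succ n ih =>
    rw [chainLcm, chainLcmDeg]
    split_ifs
    · rw [d_mul, ih (by omega), deg_chainTail d_mul d_a e J hn]
    · exact ih (by omega)

end

theorem chainTailDeg_insert (e : Prop) (J : Finset ℕ) {m n : ℕ} (h : m ≤ n) :
    chainTailDeg e (insert n J) m = chainTailDeg e J m := by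
  induction m with
  | zero => rfl
  | succ m ih =>
    have h₁ : m ∈ insert n J ↔ m ∈ J := by
      rw [Finset.mem_insert, or_iff_right (by omega)]
    have h₂ : Finset.range (m + 1) ⊆ insert n J ↔ Finset.range (m + 1) ⊆ J :=
      Finset.subset_insert_iff_of_notMem (by simp; omega)
    simp only [chainTailDeg, h₁, ih (by omega)]
    split_ifs <;> simp_all

theorem chainLcmDeg_insert (e : Prop) (J : Finset ℕ) {m n : ℕ} (h : m ≤ n) :
    chainLcmDeg e (insert n J) m = chainLcmDeg e J m := by
  induction m with
  | zero => rfl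
  | succ m ih =>
    have h₁ : m ∈ insert n J ↔ m ∈ J := by
      rw [Finset.mem_insert, or_iff_right (by omega)]
    simp only [chainLcmDeg, h₁, ih (by omega), chainTailDeg_insert e J (show m ≤ n by omega)]

theorem sum_powerset_range_succ (f : Finset ℕ → ℤ) (n : ℕ) :
    ∑ J ∈ (Finset.range (n + 1)).powerset, (-1) ^ J.card * f J =
      ∑ J ∈ (Finset.range n).powerset, (-1) ^ J.card * (f J - f (insert n J)) := by
  rw [Finset.range_add_one, Finset.sum_powerset_insert Finset.notMem_range_self,
    ← Finset.sum_add_distrib]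
  refine Finset.sum_congr rfl fun J hJ => ?_
  rw [Finset.card_insert_of_notMem fun h => Finset.notMem_range_self (Finset.mem_powerset.1 hJ h)]
  ring

open Classical in
-- Pair `J` with `insert n J`: the tail degree at `n + 1` is 1 without `n`, and with `n` it is one
-- more than the tail degree at `n`, plus 1 if `e` holds and `J` is full. The ones cancel, leaving
-- the previous sum with opposite sign and one boundary term.
theorem sum_chainTailDeg (e : Prop) (n : ℕ) :
    ∑ J ∈ (Finset.range n).powerset, (-1) ^ J.card * (chainTailDeg e J n : ℤ) =
      (-1) ^ n * if e then (n : ℤ) + 1 else 1 := by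
  induction n with
  | zero => simp [chainTailDeg]
  | succ n ih =>
    rw [sum_powerset_range_succ]
    have h : ∀ J ∈ (Finset.range n).powerset,
        (-1 : ℤ) ^ J.card * ((chainTailDeg e J (n + 1) : ℤ) -
          (chainTailDeg e (insert n J) (n + 1) : ℤ)) =
        -((-1) ^ J.card * (chainTailDeg e J n : ℤ)) -
          if J = Finset.range n then (-1) ^ n * (if e then 1 else 0) else 0 := by
      intro J hJ
      rw [Finset.mem_powerset] at hJ
      have hn : n ∉ J := fun h => Finset.notMem_range_self (hJ h)
      have hsub : Finset.range (n + 1) ⊆ insert n J ↔ J = Finset.range n := by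
        rw [Finset.range_add_one, Finset.insert_subset_insert_iff Finset.notMem_range_self]
        exact ⟨fun h => hJ.antisymm h, fun h => h.ge⟩
      simp only [chainTailDeg, hn, if_false, Finset.mem_insert_self, if_true, hsub,
        chainTailDeg_insert e J le_rfl]
      by_cases he : e <;> by_cases hJn : J = Finset.range n
      · subst hJn
        simp [he]
        ring
      all_goals
        simp [he, hJn]
        try ring
    rw [Finset.sum_congr rfl h, Finset.sum_sub_distrib, Finset.sum_neg_distrib, ih,
      Finset.sum_ite_eq' _ (Finset.range n), if_pos (Finset.mem_powerset_self _)]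
    split_ifs
    · push_cast; ring
    · ring

open Classical in
-- Adding `n` to `J` increases the lcm degree by exactly the tail degree at `n`.
theorem sum_chainLcmDeg (e : Prop) (n : ℕ) :
    ∑ J ∈ (Finset.range (n + 1)).powerset, (-1) ^ J.card * (chainLcmDeg e J (n + 1) : ℤ) =
      (-1) ^ (n + 1) * if e then (n : ℤ) + 1 else 1 := by
  have h : ∀ J ∈ (Finset.range n).powerset,
      (-1 : ℤ) ^ J.card * ((chainLcmDeg e J (n + 1) : ℤ) -
        (chainLcmDeg e (insert n J) (n + 1) : ℤ)) = -((-1) ^ J.card * (chainTailDeg e J n : ℤ)) := by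
    intro J hJ
    have hn : n ∉ J := fun h => Finset.notMem_range_self (Finset.mem_powerset.1 hJ h)
    simp only [chainLcmDeg, hn, if_false, Finset.mem_insert_self, if_true,
      chainLcmDeg_insert e J le_rfl, chainTailDeg_insert e J le_rfl]
    push_cast
    ring
  rw [sum_powerset_range_succ, Finset.sum_congr rfl h, Finset.sum_neg_distrib, sum_chainTailDeg]
  ring

end ChainDegree

/-! ### Application to types `A` and `B` -/

namespace ArtinMonoid

section

variable {I : Type*} {M : CoxeterMatrix I}

theorem join_of_letter_dvd (hM : IsSmall M) {i j : I} {X : ArtinMonoid M}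
    (h : letter M i ∣ letter M j * X) :
    ∃ W, X = altMap (mulLetter M i) (mulLetter M j) (M i j - 1) W := by
  obtain ⟨Y, hY⟩ := h
  obtain ⟨W, -, hW⟩ := join_of_mul_eq hM _ i j Y X (Nat.lt_succ_self _) hY.symm
  exact ⟨W, hW⟩

theorem letter_mul_cancel (hM : IsSmall M) {i : I} {X Y : ArtinMonoid M}
    (h : letter M i * X = letter M i * Y) : X = Y := by
  have := join_of_mul_eq hM _ i i X Y (Nat.lt_succ_self _) h
  rwa [M.diagonal, braidJoin_one_iff] at this

theorem eq_one_of_deg_eq_zero {u : ArtinMonoid M} (h : deg M u = 0) : u = 1 := by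
  obtain ⟨w, rfl⟩ := exists_ofWord M u
  rw [deg_ofWord, List.length_eq_zero_iff] at h
  rw [h]
  rfl

/-- Degrees force the cofactor to have degree 0, hence to be 1; no cancellation is involved. -/
theorem dvd_antisymm {u v : ArtinMonoid M} (h₁ : u ∣ v) (h₂ : v ∣ u) : u = v := by
  obtain ⟨c, rfl⟩ := h₁
  obtain ⟨c', h⟩ := h₂
  have h := congrArg (deg M) h
  rw [deg_mul, deg_mul] at h
  rw [eq_one_of_deg_eq_zero (u := c) (by omega), mul_one]

theorem IsRightLcm.unique {J : Finset I} {D D' : ArtinMonoid M} (h : IsRightLcm M J D)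
    (h' : IsRightLcm M J D') : D = D' :=
  dvd_antisymm (h.2 D' h'.1) (h'.2 D h.1)

theorem IsRightLcm.fundamentalElement_eq {J : Finset I} {D : ArtinMonoid M}
    (h : IsRightLcm M J D) : fundamentalElement M J = D := by
  have hex : ∃ D, IsRightLcm M J D := ⟨D, h⟩
  rw [fundamentalElement, dif_pos hex]
  exact hex.choose_spec.unique h

theorem derivative_skewGrowth_eval_one [Fintype I] :
    (derivative (skewGrowth M)).eval 1 =
      ∑ J : Finset I, (-1) ^ J.card * (deg M (fundamentalElement M J) : ℤ) := by
  rw [skewGrowth, derivative_sum, eval_finsetSum]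
  refine Finset.sum_congr rfl fun J _ => ?_
  have : ((-1 : ℤ[X]) ^ J.card) = C ((-1) ^ J.card) := by simp
  rw [this, derivative_C_mul, derivative_X_pow]
  simp

end

variable {l : ℕ}

/-- The letters of an Artin monoid on `Fin l`, indexed by the natural numbers. -/
def natLetter (M : CoxeterMatrix (Fin l)) (n : ℕ) : ArtinMonoid M :=
  if h : n < l then letter M ⟨n, h⟩ else 1

theorem natLetter_of_lt (M : CoxeterMatrix (Fin l)) {n : ℕ} (h : n < l) :
    natLetter M n = letter M ⟨n, h⟩ := dif_pos h

/-- `M` is the Coxeter matrix of a chain whose first edge carries the label `4` if `e` holds, and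
whose other edges carry the label `3`. -/
structure IsChain (M : CoxeterMatrix (Fin l)) (e : Prop) : Prop where
  two : ∀ i j : Fin l, (j : ℕ) + 1 < i → M i j = 2
  three : ∀ i j : Fin l, (i : ℕ) = j + 1 → ((j : ℕ) = 0 → ¬e) → M i j = 3
  four : ∀ i j : Fin l, (i : ℕ) = 1 → (j : ℕ) = 0 → e → M i j = 4

variable {M : CoxeterMatrix (Fin l)} {e : Prop}

/-- A chain has no triangle, and a label 4 occurs only between vertices 0 and 1, so arithmetic of
positions suffices. -/
theorem IsChain.isSmall (h : IsChain M e) : IsSmall M := by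
  have key (i j : Fin l) (hij : i ≠ j) :
      (M i j = 2 ∧ ((j : ℕ) + 1 < i ∨ (i : ℕ) + 1 < j)) ∨
      (M i j = 3 ∧ ((i : ℕ) = j + 1 ∨ (j : ℕ) = i + 1)) ∨
      (M i j = 4 ∧ ((i : ℕ) = 1 ∧ (j : ℕ) = 0 ∨ (j : ℕ) = 1 ∧ (i : ℕ) = 0)) := by
    have aux (i j : Fin l) (hij : (j : ℕ) < i) :
        (M i j = 2 ∧ ((j : ℕ) + 1 < i ∨ (i : ℕ) + 1 < j)) ∨
        (M i j = 3 ∧ ((i : ℕ) = j + 1 ∨ (j : ℕ) = i + 1)) ∨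
        (M i j = 4 ∧ ((i : ℕ) = 1 ∧ (j : ℕ) = 0 ∨ (j : ℕ) = 1 ∧ (i : ℕ) = 0)) := by
      by_cases h₁ : (j : ℕ) + 1 < i
      · exact Or.inl ⟨h.two i j h₁, Or.inl h₁⟩
      · by_cases h₂ : (j : ℕ) = 0 ∧ e
        · exact Or.inr (Or.inr ⟨h.four i j (by omega) h₂.1 h₂.2, by omega⟩)
        · exact Or.inr (Or.inl ⟨h.three i j (by omega) (fun h' he => h₂ ⟨h', he⟩), by omega⟩)
    rcases lt_or_gt_of_ne (Fin.val_ne_of_ne hij) with hlt | hlt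
    · have := aux j i hlt
      rw [M.symmetric] at this
      omega
    · exact aux i j hlt
  constructor
  · intro i j hij
    have := key i j hij
    omega
  · intro i j k hij hik hjk
    have h₁ := key i k hik
    have h₂ := key k j hjk.symm
    have h₃ := key i j hij
    rw [Ne, Fin.ext_iff] at hij hik hjk
    omega
  · intro i j k hij hik hjk
    have h₁ := key i j hij
    have h₂ := key i k hik
    rw [Ne, Fin.ext_iff] at hij hik hjk
    omega

theorem IsChain.isBraidChain (h : IsChain M e) : IsBraidChain (natLetter M) l e where
  cancel i hi X Y hXY := by
    rw [natLetter_of_lt M hi] at hXY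
    exact letter_mul_cancel h.isSmall hXY
  comm i j hij hi := by
    rw [natLetter_of_lt M hi, natLetter_of_lt M (show j < l by omega)]
    have := altMap_braid M ⟨i, hi⟩ ⟨j, by omega⟩ 1
    rw [h.two _ _ hij] at this
    simpa [altMap, mulLetter] using this
  comm_dvd i j X hij hi hd := by
    rw [natLetter_of_lt M hi] at hd ⊢
    rw [natLetter_of_lt M (show j < l by omega)] at hd
    obtain ⟨W, rfl⟩ := join_of_letter_dvd h.isSmall hd
    rw [h.two _ _ hij]
    exact dvd_mul_right _ _
  braid i hi he := by
    rw [natLetter_of_lt M hi, natLetter_of_lt M (show i < l by omega)]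
    have := altMap_braid M ⟨i + 1, hi⟩ ⟨i, by omega⟩ 1
    rw [h.three _ _ rfl he] at this
    simpa [altMap, mulLetter] using this
  braid_dvd i X hi he hd := by
    rw [natLetter_of_lt M hi, natLetter_of_lt M (show i < l by omega)] at hd ⊢
    obtain ⟨W, rfl⟩ := join_of_letter_dvd h.isSmall hd
    rw [h.three _ _ rfl he]
    exact ⟨W, (mul_assoc _ _ _).symm⟩
  four he hl := by
    rw [natLetter_of_lt M hl, natLetter_of_lt M (show 0 < l by omega)]
    have := altMap_braid M ⟨1, hl⟩ ⟨0, by omega⟩ 1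
    rw [h.four _ _ rfl rfl he] at this
    simpa [altMap, mulLetter] using this
  four_dvd X he hl hd := by
    rw [natLetter_of_lt M hl, natLetter_of_lt M (show 0 < l by omega)] at hd ⊢
    obtain ⟨W, rfl⟩ := join_of_letter_dvd h.isSmall hd
    rw [h.four _ _ rfl rfl he]
    exact ⟨W, by simp [altMap, mulLetter, mul_assoc]⟩

theorem IsChain.isRightLcm (h : IsChain M e) (J : Finset (Fin l)) :
    IsRightLcm M J (chainLcm (natLetter M) e (J.map Fin.valEmbedding) l) := by
  constructor
  · intro i hi
    have := h.isBraidChain.letter_dvd_chainLcm le_rfl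
      (Finset.mem_map_of_mem Fin.valEmbedding hi) i.isLt
    rwa [Fin.valEmbedding_apply, natLetter_of_lt M i.isLt] at this
  · intro E hE
    refine h.isBraidChain.chainLcm_dvd le_rfl fun i hi hil => ?_
    obtain ⟨j, hj, rfl⟩ := Finset.mem_map.1 hi
    rw [Fin.valEmbedding_apply, natLetter_of_lt M j.isLt]
    exact hE j hj

theorem IsChain.existsUnique_isRightLcm (h : IsChain M e) (J : Finset (Fin l)) :
    ∃! D, IsRightLcm M J D :=
  ⟨_, h.isRightLcm J, fun _ hD => hD.unique (h.isRightLcm J)⟩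

theorem IsChain.deg_fundamentalElement (h : IsChain M e) (J : Finset (Fin l)) :
    deg M (fundamentalElement M J) = chainLcmDeg e (J.map Fin.valEmbedding) l := by
  rw [(h.isRightLcm J).fundamentalElement_eq]
  exact deg_chainLcm (deg_one M) (deg_mul M)
    (fun i hi => by rw [natLetter_of_lt M hi, deg_letter]) e _ le_rfl

open Classical in
theorem IsChain.derivative_skewGrowth (h : IsChain M e) (hl : 0 < l) :
    (derivative (skewGrowth M)).eval 1 = (-1) ^ l * if e then (l : ℤ) else 1 := by
  obtain ⟨n, rfl⟩ := Nat.exists_eq_succ_of_ne_zero hl.ne'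
  have hs := sum_chainLcmDeg e n
  have hcast : ((n.succ : ℕ) : ℤ) = n + 1 := by push_cast; rfl
  rw [derivative_skewGrowth_eval_one, hcast, ← hs]
  refine Finset.sum_nbij (fun J => J.map Fin.valEmbedding) ?_ ?_ ?_ ?_
  · intro J _
    rw [Finset.mem_powerset]
    intro i hi
    obtain ⟨j, -, rfl⟩ := Finset.mem_map.1 hi
    exact Finset.mem_range.2 j.isLt
  · exact (Finset.map_injective _).injOn
  · intro K hK
    have hK := Finset.mem_powerset.1 hK
    refine ⟨K.attachFin fun i hi => Finset.mem_range.1 (hK hi), by simp, ?_⟩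
    exact Finset.map_valEmbedding_attachFin _
  · intro J _
    rw [h.deg_fundamentalElement, Finset.card_map]

theorem isChain_A : IsChain (CoxeterMatrix.A l) False where
  two i j h := by
    simp only [CoxeterMatrix.A, Matrix.of_apply, Fin.ext_iff]
    rw [if_neg (by omega), if_neg (by omega)]
  three i j h _ := by
    simp only [CoxeterMatrix.A, Matrix.of_apply, Fin.ext_iff]
    rw [if_neg (by omega), if_pos (by omega)]
  four _ _ _ _ h := h.elim

theorem isChain_typeB : IsChain (typeB l) True where
  two i j h := by
    simp only [typeB, Matrix.of_apply, Fin.ext_iff]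
    rw [if_neg (by omega), if_neg (by omega), if_neg (by omega)]
  three i j h h' := by
    have h' : (j : ℕ) ≠ 0 := fun h => h' h trivial
    simp only [typeB, Matrix.of_apply, Fin.ext_iff]
    rw [if_neg (by omega), if_neg (by omega), if_pos (by omega)]
  four i j hi hj _ := by
    simp only [typeB, Matrix.of_apply, Fin.ext_iff]
    rw [if_neg (by omega), if_pos (by omega)]

end ArtinMonoid

end

theorem theorem4p2 (l : ℕ) (hl : 2 ≤ l) :
    (∀ J : Finset (Fin l), ∃! D, ArtinMonoid.IsRightLcm (CoxeterMatrix.A l) J D) ∧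
    (∀ J : Finset (Fin l), ∃! D, ArtinMonoid.IsRightLcm (ArtinMonoid.typeB l) J D) ∧
    (Polynomial.derivative (ArtinMonoid.skewGrowth (ArtinMonoid.typeB l))).eval 1
        - (Polynomial.derivative (ArtinMonoid.skewGrowth (CoxeterMatrix.A l))).eval 1
      = (-1 : ℤ) ^ l * ((l : ℤ) - 1) ∧
    (Polynomial.derivative (ArtinMonoid.skewGrowth (ArtinMonoid.typeB l))).eval 1
      = (-1 : ℤ) ^ l * (l : ℤ) := by
  have hA := ArtinMonoid.isChain_A.derivative_skewGrowth (l := l) (by omega)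
  have hB := ArtinMonoid.isChain_typeB.derivative_skewGrowth (l := l) (by omega)
  rw [if_neg not_false] at hA
  rw [if_pos trivial] at hB
  refine ⟨ArtinMonoid.isChain_A.existsUnique_isRightLcm,
    ArtinMonoid.isChain_typeB.existsUnique_isRightLcm, ?_, hB⟩
  rw [hA, hB]
  ring
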